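/- Let $K$ be a closed connected subgroup (a subtorus) of $T^N=\{\zeta\in\mathbb{C}^N : |\zeta_i|=1\}$ with Lie algebra $k\subset t^N=\mathbb{R}^N$ (where $\mathrm{Exp}(X)=(e^{2\pi\sqrt{-1}X_i})_i$), let $\iota^*u_i\in k^*$ be the restriction to $k$ of the $i$-th coordinate function, and let $K_{\mathbb{C}}=K\,\mathrm{Exp}(\sqrt{-1}k)\subset(\mathbb{C}^\times)^N$ be the complexification of $K$. These groups act on $\mathbb{H}^N\cong\mathbb{C}^N\times\mathbb{C}^N$ by $(z,w)\zeta=(z\zeta,w\zeta^{-1})$. Put $$\mu_1(z,w)=\pi\sum_{i=1}^N(|z_i|^2-|w_i|^2)\,\iota^*u_i\in k^*,\qquad \mu_{\mathbb{C}}(z,w)=-2\pi\sqrt{-1}\sum_{i=1}^N z_iw_i\,\iota^*u_i\in k_{\mathbb{C}}^*.$$ For $(\alpha,\beta)\in k^*\times k_{\mathbb{C}}^*$ let $X(\alpha,\beta)=\bigl(\mu_1^{-1}(\alpha)\cap\mu_{\mathbb{C}}^{-1}(\beta)\bigr)/K$ be the toric hyperkähler variety, with the quotient topology. A point $(z,w)\in\mu_{\mathbb{C}}^{-1}(\beta)$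 is $\alpha$-semi-stable if $$\alpha\in\sum_{i=1}^N\mathbb{R}_{\ge0}|z_i|^2\,\iota^*u_i+\sum_{i=1}^N\mathbb{R}_{\ge0}|w_i|^2\,(-\iota^*u_i).$$ Let $\mu_{\mathbb{C}}^{-1}(\beta)^{\alpha-ss}$ be the set of these points, so that $\mu_{\mathbb{C}}^{-1}(\beta)^{0-ss}=\mu_{\mathbb{C}}^{-1}(\beta)$. Let $\mu_{\mathbb{C}}^{-1}(\beta)^{\alpha-ss}//K_{\mathbb{C}}$ be its categorical quotient: the quotient, with the quotient topology, by the equivalence relation generated by identifying two points whenever the closures of their $K_{\mathbb{C}}$-orbits in $\mu_{\mathbb{C}}^{-1}(\beta)^{\alpha-ss}$ meet. A function on an open subset of it is holomorphic if its pull-back to $\mu_{\mathbb{C}}^{-1}(\beta)^{\alpha-ss}$ is locally the restriction of a holomorphic function on an open subset of $\mathbb{C}^N\times\mathbb{C}^N$. The inclusion $\mu_1^{-1}(\alpha)\cap\mu_{\mathbb{C}}^{-1}(\beta)\subset\mu_{\mathbb{C}}^{-1}(\beta)^{\alpha-ss}$ induces the natural map $X(\alpha,\beta)\to\mu_{\mathbb{C}}^{-1}(\beta)^{\alpha-ss}//K_{\mathbb{C}}$,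 through which $(X(\alpha,\beta),I_1)$ is identified with this quotient. Then, for every $(\alpha,\beta)\in k^*\times k_{\mathbb{C}}^*$, the natural map $$\mu_{\mathbb{C}}^{-1}(\beta)^{\alpha-ss}//K_{\mathbb{C}}\to\mu_{\mathbb{C}}^{-1}(\beta)//K_{\mathbb{C}}$$ induced by the inclusion $\mu_{\mathbb{C}}^{-1}(\beta)^{\alpha-ss}\subset\mu_{\mathbb{C}}^{-1}(\beta)$ is a morphism (it is continuous and pulls holomorphic functions on open sets back to holomorphic functions), and it is proper and surjective. Moreover, there is exactly one map $\pi_1\colon X(\alpha,\beta)\to X(0,\beta)$ that corresponds to it under the natural maps from $X(\alpha,\beta)$ and $X(0,\beta)$ to these quotients, and the natural morphism $\pi_1\colon(X(\alpha,\beta),I_1)\to(X(0,\beta),I_1)$ so defined is proper and surjective. -/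

import Mathlib

namespace ToricHyperkahler

/-- The quaternionic vector space `ℍ^N`, with `ξ = z + w I₂` identified with
`(z, w) ∈ ℂ^N × ℂ^N`. The complex structure `I₁` is the standard one of `ℂ^N × ℂ^N`. -/
abbrev HN (N : ℕ) : Type := (Fin N → ℂ) × (Fin N → ℂ)

/-- The real torus `T^N`. -/
abbrev RealTorus (N : ℕ) : Type := Fin N → Circle

/-- The complex torus `(ℂ^×)^N`. -/
abbrev ComplexTorus (N : ℕ) : Type := Fin N → ℂˣ

variable {N : ℕ}

/-- The action `(z, w) ζ = (z ζ, w ζ⁻¹)` of the complex torus on `ℍ^N`. -/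
def act (ζ : ComplexTorus N) (p : HN N) : HN N :=
  (fun i => p.1 i * (ζ i : ℂ), fun i => p.2 i * ((ζ i)⁻¹ : ℂˣ))

theorem act_one (p : HN N) : act 1 p = p := by
  simp [act]

theorem act_mul (ζ ξ : ComplexTorus N) (p : HN N) : act (ζ * ξ) p = act ζ (act ξ p) := by
  ext i <;> simp [act] <;> ring

/-- The inclusion of the real torus `T^N` into the complex torus `(ℂ^×)^N`. -/
noncomputable def toComplexTorus : RealTorus N →* ComplexTorus N where
  toFun ζ := fun i => Circle.toUnits (ζ i)
  map_one' := by ext i; simp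
  map_mul' ζ ξ := by ext i; simp

/-- The exponential map `t^N = ℝ^N → T^N`, normalized so that its kernel is `ℤ^N`. -/
noncomputable def torusExp (X : Fin N → ℝ) : RealTorus N :=
  fun i => Circle.exp (2 * Real.pi * X i)

theorem torusExp_add (X Y : Fin N → ℝ) : torusExp (X + Y) = torusExp X * torusExp Y := by
  funext i
  simp only [torusExp, Pi.add_apply, Pi.mul_apply]
  rw [← Circle.exp_add]; congr 1; ring

theorem torusExp_zero : torusExp (0 : Fin N → ℝ) = 1 := by
  funext i; simp [torusExp]

/-- The Lie algebra `k ⊆ t^N = ℝ^N` of a subgroup `K` of `T^N`. -/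
noncomputable def lieAlg (K : Subgroup (RealTorus N)) : Submodule ℝ (Fin N → ℝ) where
  carrier := {X | ∀ t : ℝ, torusExp (t • X) ∈ K}
  zero_mem' := fun t => by
    rw [smul_zero, torusExp_zero]; exact K.one_mem
  add_mem' := fun {X Y} hX hY t => by
    rw [smul_add, torusExp_add]; exact K.mul_mem (hX t) (hY t)
  smul_mem' := fun c X hX t => by
    rw [smul_smul]; exact hX (t * c)

/-- `Exp (√-1 Y) ∈ (ℂ^×)^N` for `Y ∈ t^N = ℝ^N`; its `i`-th entry is
`exp (2 π √-1 · √-1 Y_i) = exp (-2 π Y_i)`. -/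
noncomputable def imagExp (Y : Fin N → ℝ) : ComplexTorus N :=
  fun i => Units.mk0 (Complex.exp (2 * Real.pi * Complex.I * (Complex.I * Y i)))
    (Complex.exp_ne_zero _)

theorem imagExp_add (X Y : Fin N → ℝ) : imagExp (X + Y) = imagExp X * imagExp Y := by
  ext i
  simp only [imagExp, Pi.add_apply, Pi.mul_apply, Units.val_mul, Units.val_mk0]
  rw [← Complex.exp_add]; congr 1; push_cast; ring

theorem imagExp_zero : imagExp (0 : Fin N → ℝ) = 1 := by
  ext i; simp [imagExp]

/-- The complexification `K_ℂ = K · Exp (√-1 k) ⊆ (ℂ^×)^N` of `K ⊆ T^N`. -/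
noncomputable def complexification (K : Subgroup (RealTorus N)) : Subgroup (ComplexTorus N) where
  carrier := {ζ | ∃ g ∈ K, ∃ Y ∈ lieAlg K, ζ = toComplexTorus g * imagExp Y}
  one_mem' := ⟨1, K.one_mem, 0, (lieAlg K).zero_mem, by rw [imagExp_zero, map_one, one_mul]⟩
  mul_mem' := by
    rintro _ _ ⟨g, hg, Y, hY, rfl⟩ ⟨h, hh, Z, hZ, rfl⟩
    exact ⟨g * h, K.mul_mem hg hh, Y + Z, (lieAlg K).add_mem hY hZ, by
      rw [map_mul, imagExp_add, mul_mul_mul_comm]⟩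
  inv_mem' := by
    rintro _ ⟨g, hg, Y, hY, rfl⟩
    refine ⟨g⁻¹, K.inv_mem hg, -Y, (lieAlg K).neg_mem hY, ?_⟩
    have h : imagExp Y * imagExp (-Y) = 1 := by rw [← imagExp_add, add_neg_cancel, imagExp_zero]
    rw [map_inv, mul_inv, eq_inv_of_mul_eq_one_right h]

theorem toComplexTorus_mem {K : Subgroup (RealTorus N)} {g : RealTorus N} (hg : g ∈ K) :
    toComplexTorus g ∈ complexification K :=
  ⟨g, hg, 0, (lieAlg K).zero_mem, by rw [imagExp_zero, mul_one]⟩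

/-- The dual space `k^*`. -/
abbrev KDual (K : Subgroup (RealTorus N)) : Type := lieAlg K →ₗ[ℝ] ℝ

/-- The complexified dual space `k_ℂ^* = Hom_ℂ (k ⊗ ℂ, ℂ)`, that is, the space of real linear
maps `k → ℂ`. -/
abbrev KDualC (K : Subgroup (RealTorus N)) : Type := lieAlg K →ₗ[ℝ] ℂ

/-- `ι^* u_i ∈ k^*`, the restriction to `k` of the `i`-th coordinate function of `t^N = ℝ^N`. -/
noncomputable def weight (K : Subgroup (RealTorus N)) (i : Fin N) : KDual K :=
  (LinearMap.proj i : (Fin N → ℝ) →ₗ[ℝ] ℝ).comp (lieAlg K).subtype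

/-- The real moment map `μ₁ (z, w) = π ∑ (|z_i|² - |w_i|²) ι^* u_i`. -/
noncomputable def momentR (K : Subgroup (RealTorus N)) (p : HN N) : KDual K :=
  ∑ i, (Real.pi * (‖p.1 i‖ ^ 2 - ‖p.2 i‖ ^ 2)) • weight K i

/-- The complex moment map `μ_ℂ (z, w) = -2 π √-1 ∑ z_i w_i ι^* u_i`. -/
noncomputable def momentC (K : Subgroup (RealTorus N)) (p : HN N) : KDualC K :=
  ∑ i, (weight K i).smulRight (-2 * Real.pi * Complex.I * (p.1 i * p.2 i))

/-- The level set `μ⁻¹ (α, β)` of the hyperkähler moment map. -/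
abbrev Level (K : Subgroup (RealTorus N)) (α : KDual K) (β : KDualC K) : Type :=
  {p : HN N // momentR K p = α ∧ momentC K p = β}

/-- Two points of `μ⁻¹ (α, β)` are equivalent if they lie in the same `K`-orbit. -/
def levelSetoid (K : Subgroup (RealTorus N)) (α : KDual K) (β : KDualC K) :
    Setoid (Level K α β) where
  r p q := ∃ g ∈ K, act (toComplexTorus g) p.1 = q.1
  iseqv :=
    { refl := fun p => ⟨1, K.one_mem, by rw [map_one, act_one]⟩
      symm := by
        rintro p q ⟨g, hg, h⟩
        exact ⟨g⁻¹, K.inv_mem hg, by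
          rw [← h, ← act_mul, ← map_mul, inv_mul_cancel, map_one, act_one]⟩
      trans := by
        rintro p q r ⟨g, hg, h⟩ ⟨g', hg', h'⟩
        exact ⟨g' * g, K.mul_mem hg' hg, by rw [map_mul, act_mul, h, h']⟩ }

/-- The toric hyperkähler variety `X(α, β) = μ⁻¹ (α, β) / K`, with the quotient topology. -/
abbrev X (K : Subgroup (RealTorus N)) (α : KDual K) (β : KDualC K) : Type :=
  Quotient (levelSetoid K α β)

/-- `α`-semi-stability of `(z, w)`, for an arbitrary real parameter `α ∈ k^*`:
`α ∈ ∑ ℝ_{≥0} |z_i|² ι^* u_i + ∑ ℝ_{≥0} |w_i|² (-ι^* u_i)`. -/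
def IsSemistable (K : Subgroup (RealTorus N)) (α : KDual K) (p : HN N) : Prop :=
  ∃ a b : Fin N → ℝ, (∀ i, 0 ≤ a i) ∧ (∀ i, 0 ≤ b i) ∧
    α = ∑ i, (a i * ‖p.1 i‖ ^ 2) • weight K i + ∑ i, (b i * ‖p.2 i‖ ^ 2) • (-weight K i)

theorem isSemistable_zero (K : Subgroup (RealTorus N)) (p : HN N) : IsSemistable K 0 p :=
  ⟨0, 0, fun _ => le_rfl, fun _ => le_rfl, by simp⟩

theorem isSemistable_momentR (K : Subgroup (RealTorus N)) (p : HN N) :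
    IsSemistable K (momentR K p) p := by
  refine ⟨fun _ => Real.pi, fun _ => Real.pi, fun _ => Real.pi_pos.le,
    fun _ => Real.pi_pos.le, ?_⟩
  rw [← Finset.sum_add_distrib]
  refine Finset.sum_congr rfl fun i _ => ?_
  ext x
  simp
  ring

/-- The set `μ_ℂ⁻¹ (β)^{α-ss}` of `α`-semi-stable points of `μ_ℂ⁻¹ (β)`. -/
abbrev Semistable (K : Subgroup (RealTorus N)) (α : KDual K) (β : KDualC K) : Type :=
  {p : HN N // momentC K p = β ∧ IsSemistable K α p}

/-- The `K_ℂ`-orbit of `p` in `μ_ℂ⁻¹ (β)^{α-ss}`. -/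
def orbit {K : Subgroup (RealTorus N)} {α : KDual K} {β : KDualC K} (p : Semistable K α β) :
    Set (Semistable K α β) :=
  {q | ∃ ζ ∈ complexification K, act ζ p.1 = q.1}

/-- Two `α`-semi-stable points are identified in the categorical quotient if the closures of
their `K_ℂ`-orbits in `μ_ℂ⁻¹ (β)^{α-ss}` meet. -/
def OrbitClosuresMeet {K : Subgroup (RealTorus N)} {α : KDual K} {β : KDualC K}
    (p q : Semistable K α β) : Prop :=
  (closure (orbit p) ∩ closure (orbit q)).Nonempty

/-- The categorical quotient `μ_ℂ⁻¹ (β)^{α-ss} // K_ℂ`, with the quotient topology. -/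
abbrev GIT (K : Subgroup (RealTorus N)) (α : KDual K) (β : KDualC K) : Type :=
  Quot (OrbitClosuresMeet (K := K) (α := α) (β := β))

/-- The function `f` on the subset `U` of `μ_ℂ⁻¹ (β)^{α-ss} // K_ℂ` is holomorphic: its pull-back
to `μ_ℂ⁻¹ (β)^{α-ss}` is locally the restriction of an `I₁`-holomorphic function on an open subset
of `ℍ^N`. -/
def IsHolomorphicOn {K : Subgroup (RealTorus N)} {α : KDual K} {β : KDualC K}
    (U : Set (GIT K α β)) (f : GIT K α β → ℂ) : Prop :=
  ∀ p : Semistable K α β, Quot.mk _ p ∈ U →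
    ∃ V : Set (HN N), IsOpen V ∧ p.1 ∈ V ∧ ∃ F : HN N → ℂ, DifferentiableOn ℂ F V ∧
      ∀ q : Semistable K α β, q.1 ∈ V → Quot.mk _ q ∈ U → f (Quot.mk _ q) = F q.1

/-- A map between categorical quotients is a morphism of complex spaces: it is continuous and
pulls back holomorphic functions on open sets to holomorphic functions. -/
def IsMorphism {K : Subgroup (RealTorus N)} {α α' : KDual K} {β β' : KDualC K}
    (φ : GIT K α β → GIT K α' β') : Prop :=
  Continuous φ ∧ ∀ (U : Set (GIT K α' β')) (f : GIT K α' β' → ℂ), IsOpen U →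
    IsHolomorphicOn U f → IsHolomorphicOn (φ ⁻¹' U) (f ∘ φ)

/-- The inclusion `μ⁻¹ (α, β) ⊆ μ_ℂ⁻¹ (β)^{α-ss}`. -/
def levelToSemistable {K : Subgroup (RealTorus N)} {α : KDual K} {β : KDualC K}
    (p : Level K α β) : Semistable K α β :=
  ⟨p.1, p.2.2, by have h := isSemistable_momentR K p.1; rwa [p.2.1] at h⟩

theorem mem_orbit_self {K : Subgroup (RealTorus N)} {α : KDual K} {β : KDualC K}
    (p : Semistable K α β) : p ∈ orbit p :=
  ⟨1, (complexification K).one_mem, act_one _⟩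

/-- The natural map `X(α, β) → μ_ℂ⁻¹ (β)^{α-ss} // K_ℂ` induced by the inclusion
`μ⁻¹ (α, β) ⊆ μ_ℂ⁻¹ (β)^{α-ss}`. -/
def toGIT (K : Subgroup (RealTorus N)) (α : KDual K) (β : KDualC K) : X K α β → GIT K α β :=
  Quotient.lift (fun p => Quot.mk _ (levelToSemistable p)) (by
    rintro p q ⟨g, hg, h⟩
    refine Quot.sound ⟨levelToSemistable q, subset_closure ?_, subset_closure (mem_orbit_self _)⟩
    exact ⟨toComplexTorus g, toComplexTorus_mem hg, h⟩)

/-- The inclusion `μ_ℂ⁻¹ (β)^{α-ss} ⊆ μ_ℂ⁻¹ (β) = μ_ℂ⁻¹ (β)^{0-ss}`. -/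
def semistableInclusion {K : Subgroup (RealTorus N)} {α : KDual K} {β : KDualC K}
    (p : Semistable K α β) : Semistable K 0 β :=
  ⟨p.1, p.2.1, isSemistable_zero K p.1⟩

theorem semistableInclusion_closure {K : Subgroup (RealTorus N)} {α : KDual K} {β : KDualC K}
    {p r : Semistable K α β} (h : r ∈ closure (orbit p)) :
    semistableInclusion r ∈ closure (orbit (semistableInclusion p)) := by
  have hc : Continuous (semistableInclusion (K := K) (α := α) (β := β)) :=
    Continuous.subtype_mk continuous_subtype_val _
  exact map_mem_closure hc h fun q hq => hq

/-- The natural morphism `μ_ℂ⁻¹ (β)^{α-ss} // K_ℂ → μ_ℂ⁻¹ (β) // K_ℂ` of quotients, induced by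
the inclusion `μ_ℂ⁻¹ (β)^{α-ss} ⊆ μ_ℂ⁻¹ (β)`. -/
def gitMap (K : Subgroup (RealTorus N)) (α : KDual K) (β : KDualC K) :
    GIT K α β → GIT K 0 β :=
  Quot.map semistableInclusion (by
    rintro p q ⟨r, hp, hq⟩
    exact ⟨semistableInclusion r, semistableInclusion_closure hp, semistableInclusion_closure hq⟩)

/-- `π : X(α, β) → X(0, β)` is the map corresponding to the natural morphism of quotients
`gitMap` under the natural maps from the hyperkähler quotients to the categorical quotients. -/
def IsNaturalMap (K : Subgroup (RealTorus N)) (α : KDual K) (β : KDualC K)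
    (π : X K α β → X K 0 β) : Prop :=
  ∀ x : X K α β, toGIT K 0 β (π x) = gitMap K α β (toGIT K α β x)

end ToricHyperkahler

open Filter Topology

namespace ToricHyperkahler

variable {N : ℕ}

/-! The proof is the Kempf–Ness argument made explicit for a torus. On the orbit directions `Exp
(√-1 k)`, the function `kempfNess` is convex. Semi-stability bounds it below, a minimizing sequence
converges in `ℍ^N`, and the limit lies on the real level set (`exists_tendsto_momentR_eq`). Hence
`toGIT` is surjective.

Conversely, two points with equal `momentR` in the closure of the orbit relation lie in one
`K`-orbit (`exists_act_eq_of_mem_orbitGraphClosure`). Thus `X(α, β)` is Hausdorff and, since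
minimizing at `α = 0` does not increase the norm, `toGIT` is a homeomorphism there
(`gitZeroHomeomorph`).

Properness reduces to one estimate: points of a fixed real level set whose orbits enter a fixed ball
are bounded (`exists_norm_le_of_momentR_eq`). Surjectivity follows by perturbing each zero-level
point to an `α`-semi-stable point that degenerates to it (`exists_isSemistable_mem_closure`). -/

theorem act_imagExp_fst (Y : Fin N → ℝ) (p : HN N) (i : Fin N) :
    (act (imagExp Y) p).1 i = p.1 i * (Real.exp (-(2 * Real.pi * Y i)) : ℝ) := by
  simp only [act, imagExp, Units.val_mk0, Complex.ofReal_exp]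
  congr 2
  push_cast
  linear_combination (2 * Real.pi * Y i : ℂ) * Complex.I_mul_I

theorem act_imagExp_snd (Y : Fin N → ℝ) (p : HN N) (i : Fin N) :
    (act (imagExp Y) p).2 i = p.2 i * (Real.exp (2 * Real.pi * Y i) : ℝ) := by
  simp only [act, imagExp, Units.val_inv_eq_inv_val, Units.val_mk0, Complex.ofReal_exp,
    ← Complex.exp_neg]
  congr 2
  push_cast
  linear_combination (-2 * Real.pi * Y i : ℂ) * Complex.I_mul_I

theorem norm_act_imagExp_fst (Y : Fin N → ℝ) (p : HN N) (i : Fin N) :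
    ‖(act (imagExp Y) p).1 i‖ = ‖p.1 i‖ * Real.exp (-(2 * Real.pi * Y i)) := by
  rw [act_imagExp_fst, norm_mul, Complex.norm_real, Real.norm_of_nonneg (Real.exp_pos _).le]

theorem norm_act_imagExp_snd (Y : Fin N → ℝ) (p : HN N) (i : Fin N) :
    ‖(act (imagExp Y) p).2 i‖ = ‖p.2 i‖ * Real.exp (2 * Real.pi * Y i) := by
  rw [act_imagExp_snd, norm_mul, Complex.norm_real, Real.norm_of_nonneg (Real.exp_pos _).le]

theorem norm_act_toComplexTorus_fst (g : RealTorus N) (p : HN N) (i : Fin N) :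
    ‖(act (toComplexTorus g) p).1 i‖ = ‖p.1 i‖ := by
  simp [act, toComplexTorus, Circle.norm_coe]

theorem norm_act_toComplexTorus_snd (g : RealTorus N) (p : HN N) (i : Fin N) :
    ‖(act (toComplexTorus g) p).2 i‖ = ‖p.2 i‖ := by
  simp [act, toComplexTorus, Circle.norm_coe]

theorem norm_act_toComplexTorus (g : RealTorus N) (p : HN N) :
    ‖act (toComplexTorus g) p‖ = ‖p‖ := by
  simp only [Prod.norm_def, Pi.norm_def]
  congr 3 <;> ext i <;>
    simp [norm_act_toComplexTorus_fst, norm_act_toComplexTorus_snd]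

theorem continuous_act (ζ : ComplexTorus N) : Continuous (act ζ) := by
  unfold act; fun_prop

theorem continuous_act_toComplexTorus :
    Continuous fun x : RealTorus N × HN N => act (toComplexTorus x.1) x.2 := by
  have h : (fun x : RealTorus N × HN N => act (toComplexTorus x.1) x.2) =
      fun x : RealTorus N × HN N => (fun i => x.2.1 i * (x.1 i : ℂ),
        fun i => x.2.2 i * ((x.1 i)⁻¹ : Circle)) := by
    funext x
    simp [act, toComplexTorus]
  rw [h]
  fun_prop

theorem momentR_apply (K : Subgroup (RealTorus N)) (p : HN N) (Y : lieAlg K) :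
    momentR K p Y = ∑ i, Real.pi * (‖p.1 i‖ ^ 2 - ‖p.2 i‖ ^ 2) * (Y : Fin N → ℝ) i := by
  simp [momentR, weight, LinearMap.sum_apply]

theorem momentR_act_toComplexTorus (K : Subgroup (RealTorus N)) (g : RealTorus N) (p : HN N) :
    momentR K (act (toComplexTorus g) p) = momentR K p := by
  simp [momentR, norm_act_toComplexTorus_fst, norm_act_toComplexTorus_snd]

theorem continuous_momentR_apply (K : Subgroup (RealTorus N)) (Y : lieAlg K) :
    Continuous fun p => momentR K p Y := by
  simp only [momentR_apply]
  fun_prop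

theorem isClosed_momentR_eq (K : Subgroup (RealTorus N)) (α : KDual K) :
    IsClosed {p | momentR K p = α} := by
  simp only [LinearMap.ext_iff, Set.ofPred_forall]
  exact isClosed_iInter fun Y => isClosed_eq (continuous_momentR_apply K Y) continuous_const

theorem momentC_eq_of_mul_eq (K : Subgroup (RealTorus N)) {p q : HN N}
    (h : ∀ i, p.1 i * p.2 i = q.1 i * q.2 i) : momentC K p = momentC K q := by
  simp [momentC, h]

theorem momentC_act (K : Subgroup (RealTorus N)) (ζ : ComplexTorus N) (p : HN N) :
    momentC K (act ζ p) = momentC K p := by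
  refine momentC_eq_of_mul_eq K fun i => ?_
  simp only [act, Units.val_inv_eq_inv_val]
  have := (ζ i).ne_zero
  field_simp

theorem isClosed_momentC_eq (K : Subgroup (RealTorus N)) (β : KDualC K) :
    IsClosed {p | momentC K p = β} := by
  simp only [LinearMap.ext_iff, Set.ofPred_forall]
  refine isClosed_iInter fun Y => isClosed_eq ?_ continuous_const
  simp only [momentC, LinearMap.sum_apply, LinearMap.smulRight_apply]
  fun_prop

/-! ### Closure of the orbit relation and separation of `K`-orbits -/

/-- The graph closure of the orbit relation of `K_ℂ` on `ℍ^N`. -/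
def orbitGraphClosure (K : Subgroup (RealTorus N)) : Set (HN N × HN N) :=
  closure {x | ∃ ζ ∈ complexification K, act ζ x.1 = x.2}

theorem imagExp_mem {K : Subgroup (RealTorus N)} (Y : lieAlg K) :
    imagExp (Y : Fin N → ℝ) ∈ complexification K :=
  ⟨1, K.one_mem, Y, Y.2, by rw [map_one, one_mul]⟩

theorem orbitGraphClosure_symm {K : Subgroup (RealTorus N)} {p q : HN N}
    (h : (p, q) ∈ orbitGraphClosure K) : (q, p) ∈ orbitGraphClosure K := by
  refine map_mem_closure (f := Prod.swap) continuous_swap h ?_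
  rintro ⟨a, b⟩ ⟨ζ, hζ, hb⟩
  obtain rfl : act ζ a = b := hb
  exact ⟨ζ⁻¹, inv_mem hζ, by simp [← act_mul, act_one]⟩

/-- The condition on the first variable is closed and `K_ℂ`-invariant, so it spreads from a point to
its orbit closure. -/
theorem orbitGraphClosure_of_mem_closure {K : Subgroup (RealTorus N)} {p r q : HN N}
    (h : (p, q) ∈ orbitGraphClosure K)
    (hr : r ∈ closure {x | ∃ ζ ∈ complexification K, act ζ p = x}) :
    (r, q) ∈ orbitGraphClosure K := by
  have hc : IsClosed {x : HN N | (x, q) ∈ orbitGraphClosure K} :=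
    isClosed_closure.preimage (by fun_prop : Continuous fun x : HN N => (x, q))
  refine closure_minimal ?_ hc hr
  rintro x ⟨ζ, hζ, rfl⟩
  have hcont : Continuous fun x : HN N × HN N => (act ζ x.1, x.2) :=
    ((continuous_act ζ).comp continuous_fst).prodMk continuous_snd
  refine map_mem_closure (f := fun x : HN N × HN N => (act ζ x.1, x.2)) hcont h ?_
  rintro ⟨a, b⟩ ⟨ξ, hξ, hb⟩
  obtain rfl : act ξ a = b := hb
  exact ⟨ξ * ζ⁻¹, mul_mem hξ (inv_mem hζ), by simp [← act_mul]⟩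

theorem orbitGraphClosure_refl (K : Subgroup (RealTorus N)) (p : HN N) :
    (p, p) ∈ orbitGraphClosure K :=
  subset_closure ⟨1, one_mem _, act_one p⟩

/-- A strict inequality between `‖a‖` and `‖b‖` persists for large `n` and fixes the sign of `c n`,
even if `c` diverges. The equality clause serves to exploit a vanishing sum of such terms. -/
theorem mul_nonneg_of_tendsto_mul_exp {x y : ℕ → ℂ} {c : ℕ → ℝ} {a b : ℂ}
    (hx : Tendsto x atTop (𝓝 a)) (hy : Tendsto y atTop (𝓝 b))
    (h : ∀ n, y n = x n * (Real.exp (-(2 * Real.pi * c n)) : ℝ)) :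
    ∀ᶠ n in atTop, 0 ≤ (‖a‖ ^ 2 - ‖b‖ ^ 2) * c n ∧
      ((‖a‖ ^ 2 - ‖b‖ ^ 2) * c n = 0 → ‖a‖ = ‖b‖) := by
  have hn : ∀ n, ‖y n‖ = ‖x n‖ * Real.exp (-(2 * Real.pi * c n)) := fun n => by
    rw [h, norm_mul, Complex.norm_real, Real.norm_of_nonneg (Real.exp_pos _).le]
  rcases lt_trichotomy ‖a‖ ‖b‖ with hab | hab | hab
  · filter_upwards [hx.norm.eventually_lt hy.norm hab] with n hlt
    have hc : c n < 0 := by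
      by_contra! hc
      have : Real.exp (-(2 * Real.pi * c n)) ≤ 1 :=
        Real.exp_le_one_iff.2 (by have := Real.pi_pos; simp only [Left.neg_nonpos_iff]; positivity)
      have := mul_le_of_le_one_right (norm_nonneg (x n)) this
      linarith [hn n]
    have hs : ‖a‖ ^ 2 - ‖b‖ ^ 2 < 0 := by
      have := pow_lt_pow_left₀ hab (norm_nonneg _) two_ne_zero
      linarith
    have := mul_pos_of_neg_of_neg hs hc
    exact ⟨this.le, fun h => absurd h this.ne'⟩
  · exact Eventually.of_forall fun n => ⟨by simp [hab], fun _ => hab⟩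
  · filter_upwards [hy.norm.eventually_lt hx.norm hab] with n hlt
    have hc : 0 < c n := by
      by_contra! hc
      have : 1 ≤ Real.exp (-(2 * Real.pi * c n)) :=
        Real.one_le_exp (by have := Real.pi_pos; nlinarith)
      have := le_mul_of_one_le_right (norm_nonneg (x n)) this
      linarith [hn n]
    have hs : 0 < ‖a‖ ^ 2 - ‖b‖ ^ 2 := by
      have := pow_lt_pow_left₀ hab (norm_nonneg _) two_ne_zero
      linarith
    have := mul_pos hs hc
    exact ⟨this.le, fun h => absurd h this.ne'⟩

/-- Positive real factors preserve the argument: `‖y n‖ * x n = ‖x n‖ * y n` passes to the limit. -/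
theorem eq_of_tendsto_mul_exp {x y : ℕ → ℂ} {c : ℕ → ℝ} {a b : ℂ}
    (hx : Tendsto x atTop (𝓝 a)) (hy : Tendsto y atTop (𝓝 b))
    (h : ∀ n, y n = x n * (Real.exp (-(2 * Real.pi * c n)) : ℝ)) (hab : ‖a‖ = ‖b‖) :
    a = b := by
  have h1 : (‖b‖ : ℂ) * a = ‖a‖ * b := by
    refine tendsto_nhds_unique (f := fun n => (‖y n‖ : ℂ) * x n)
      ((Complex.continuous_ofReal.tendsto _).comp hy.norm |>.mul hx) ?_
    have : (fun n => (‖y n‖ : ℂ) * x n) = fun n => (‖x n‖ : ℂ) * y n := by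
      funext n
      rw [h n, norm_mul, Complex.norm_real, Real.norm_of_nonneg (Real.exp_pos _).le]
      push_cast
      ring
    rw [this]
    exact (Complex.continuous_ofReal.tendsto _).comp hx.norm |>.mul hy
  rcases eq_or_ne a 0 with ha | ha
  · rw [ha, norm_zero] at hab
    rw [ha, norm_eq_zero.1 hab.symm]
  · rw [← hab] at h1
    exact mul_left_cancel₀ (by simpa using ha) h1

/-- Pairing the zero difference of moments with a single `Y n`, `n` large, gives a vanishing sum of
nonnegative terms. All coordinate norms therefore agree. No convergence of `Y` is needed. -/
theorem eq_of_tendsto_act_imagExp {K : Subgroup (RealTorus N)} {p : ℕ → HN N}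
    {Y : ℕ → lieAlg K} {t q : HN N} (hp : Tendsto p atTop (𝓝 t))
    (hq : Tendsto (fun n => act (imagExp (Y n : Fin N → ℝ)) (p n)) atTop (𝓝 q))
    (h : momentR K t = momentR K q) : t = q := by
  have hp1 : ∀ i, Tendsto (fun n => (p n).1 i) atTop (𝓝 (t.1 i)) := fun i =>
    ((continuous_apply i).comp continuous_fst).continuousAt.tendsto.comp hp
  have hp2 : ∀ i, Tendsto (fun n => (p n).2 i) atTop (𝓝 (t.2 i)) := fun i =>
    ((continuous_apply i).comp continuous_snd).continuousAt.tendsto.comp hp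
  have hq1 : ∀ i, Tendsto (fun n => (act (imagExp (Y n : Fin N → ℝ)) (p n)).1 i) atTop
      (𝓝 (q.1 i)) := fun i =>
    ((continuous_apply i).comp continuous_fst).continuousAt.tendsto.comp hq
  have hq2 : ∀ i, Tendsto (fun n => (act (imagExp (Y n : Fin N → ℝ)) (p n)).2 i) atTop
      (𝓝 (q.2 i)) := fun i =>
    ((continuous_apply i).comp continuous_snd).continuousAt.tendsto.comp hq
  have e1 : ∀ i n, (act (imagExp (Y n : Fin N → ℝ)) (p n)).1 i =
      (p n).1 i * (Real.exp (-(2 * Real.pi * (Y n : Fin N → ℝ) i)) : ℝ) := fun i n =>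
    act_imagExp_fst _ _ _
  have e2 : ∀ i n, (act (imagExp (Y n : Fin N → ℝ)) (p n)).2 i =
      (p n).2 i * (Real.exp (-(2 * Real.pi * (-(Y n : Fin N → ℝ) i))) : ℝ) := fun i n => by
    rw [act_imagExp_snd, mul_neg, neg_neg]
  obtain ⟨n, hn⟩ := ((eventually_all.2 fun i =>
    mul_nonneg_of_tendsto_mul_exp (hp1 i) (hq1 i) (e1 i)).and (eventually_all.2 fun i =>
    mul_nonneg_of_tendsto_mul_exp (hp2 i) (hq2 i) (e2 i))).exists
  have hsum : ∑ i, ((‖t.1 i‖ ^ 2 - ‖q.1 i‖ ^ 2) * (Y n : Fin N → ℝ) i +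
      (‖t.2 i‖ ^ 2 - ‖q.2 i‖ ^ 2) * -(Y n : Fin N → ℝ) i) = 0 := by
    have := LinearMap.congr_fun h (Y n)
    rw [momentR_apply, momentR_apply, ← sub_eq_zero, ← Finset.sum_sub_distrib] at this
    have h2 : Real.pi * ∑ i, ((‖t.1 i‖ ^ 2 - ‖q.1 i‖ ^ 2) * (Y n : Fin N → ℝ) i +
      (‖t.2 i‖ ^ 2 - ‖q.2 i‖ ^ 2) * -(Y n : Fin N → ℝ) i) = 0 := by
      rw [← this, Finset.mul_sum]
      exact Finset.sum_congr rfl fun i _ => by ring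
    exact (mul_eq_zero.1 h2).resolve_left Real.pi_ne_zero
  rw [Finset.sum_eq_zero_iff_of_nonneg fun i _ => add_nonneg (hn.1 i).1 (hn.2 i).1] at hsum
  have hz := fun i => (add_eq_zero_iff_of_nonneg (hn.1 i).1 (hn.2 i).1).1 (hsum i (Finset.mem_univ i))
  ext i
  · exact eq_of_tendsto_mul_exp (hp1 i) (hq1 i) (e1 i) ((hn.1 i).2 (hz i).1)
  · exact eq_of_tendsto_mul_exp (hp2 i) (hq2 i) (e2 i) ((hn.2 i).2 (hz i).2)

theorem exists_act_eq_of_mem_orbitGraphClosure {K : Subgroup (RealTorus N)}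
    (hK : IsClosed (K : Set (RealTorus N))) {t q : HN N} (h : (t, q) ∈ orbitGraphClosure K)
    (hm : momentR K t = momentR K q) : ∃ g ∈ K, act (toComplexTorus g) t = q := by
  obtain ⟨x, hx, hlim⟩ := mem_closure_iff_seq_limit.1 h
  choose ζ hζ hact using hx
  choose g hg Y hY hgY using hζ
  -- Compactness of `K` removes the unitary part: along a subsequence it converges and can be moved
  -- onto `q`.
  obtain ⟨g₀, hg₀, φ, hφ, hgφ⟩ := hK.isCompact.tendsto_subseq hg
  have hx1 : Tendsto (fun n => (x (φ n)).1) atTop (𝓝 t) :=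
    (continuous_fst.tendsto _).comp (hlim.comp hφ.tendsto_atTop)
  have hx2 : Tendsto (fun n => (x (φ n)).2) atTop (𝓝 q) :=
    (continuous_snd.tendsto _).comp (hlim.comp hφ.tendsto_atTop)
  have hlim2 : Tendsto (fun n => act (imagExp ((⟨Y (φ n), hY (φ n)⟩ : lieAlg K) : Fin N → ℝ))
      (x (φ n)).1) atTop (𝓝 (act (toComplexTorus g₀⁻¹) q)) := by
    have h1 := (continuous_act_toComplexTorus.tendsto (g₀⁻¹, q)).comp
      ((hgφ.inv).prodMk_nhds hx2)
    refine h1.congr fun n => ?_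
    simp only [Function.comp_apply]
    rw [← hact, hgY, ← act_mul, ← mul_assoc, ← map_mul, inv_mul_cancel, map_one, one_mul]
  have := eq_of_tendsto_act_imagExp hx1 hlim2 (by rw [momentR_act_toComplexTorus, hm])
  exact ⟨g₀, hg₀, by rw [this, ← act_mul, ← map_mul, mul_inv_cancel, map_one, act_one]⟩

/-! ### The Kempf–Ness function and its minimizing sequences -/

/-- The squared Euclidean norm on `ℍ^N`. -/
noncomputable def sqNorm (p : HN N) : ℝ := ∑ i, (‖p.1 i‖ ^ 2 + ‖p.2 i‖ ^ 2)

theorem continuous_sqNorm : Continuous (sqNorm (N := N)) := by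
  unfold sqNorm; fun_prop

theorem norm_sq_le_sqNorm (p : HN N) : ‖p‖ ^ 2 ≤ sqNorm p := by
  have h0 : 0 ≤ sqNorm p := Finset.sum_nonneg fun i _ => by positivity
  have hi : ∀ i, ‖p.1 i‖ ^ 2 + ‖p.2 i‖ ^ 2 ≤ sqNorm p := fun i =>
    Finset.single_le_sum (f := fun i => ‖p.1 i‖ ^ 2 + ‖p.2 i‖ ^ 2)
      (fun i _ => by positivity) (Finset.mem_univ i)
  have h : ‖p‖ ≤ √(sqNorm p) := by
    refine max_le ((pi_norm_le_iff_of_nonneg (Real.sqrt_nonneg _)).2 fun i => ?_)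
      ((pi_norm_le_iff_of_nonneg (Real.sqrt_nonneg _)).2 fun i => ?_) <;>
    refine Real.le_sqrt_of_sq_le ((?_ : _ ≤ _).trans (hi i)) <;>
    nlinarith [sq_nonneg ‖p.1 i‖, sq_nonneg ‖p.2 i‖]
  calc ‖p‖ ^ 2 ≤ √(sqNorm p) ^ 2 := by gcongr
    _ = sqNorm p := Real.sq_sqrt h0

theorem sqNorm_act_toComplexTorus (g : RealTorus N) (p : HN N) :
    sqNorm (act (toComplexTorus g) p) = sqNorm p := by
  simp [sqNorm, norm_act_toComplexTorus_fst, norm_act_toComplexTorus_snd]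

theorem sqNorm_act_imagExp (Y : Fin N → ℝ) (p : HN N) :
    sqNorm (act (imagExp Y) p) = ∑ i, (‖p.1 i‖ ^ 2 * Real.exp (-(4 * Real.pi * Y i)) +
      ‖p.2 i‖ ^ 2 * Real.exp (4 * Real.pi * Y i)) := by
  refine Finset.sum_congr rfl fun i _ => ?_
  rw [norm_act_imagExp_fst, norm_act_imagExp_snd, mul_pow, mul_pow, ← Real.exp_nat_mul,
    ← Real.exp_nat_mul]
  congr 3 <;> push_cast <;> ring_nf

/-- Coordinatewise this is `(e^u - e^v)² = e^(2u) + e^(2v) - 2 e^(u+v)`. This quantitative convexity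
controls distances in the orbit, even where `Y - Z` is unbounded. -/
theorem sqNorm_act_imagExp_sub (Y Z : Fin N → ℝ) (p : HN N) :
    sqNorm (act (imagExp Y) p - act (imagExp Z) p) = sqNorm (act (imagExp Y) p) +
      sqNorm (act (imagExp Z) p) - 2 * sqNorm (act (imagExp ((1 / 2 : ℝ) • (Y + Z))) p) := by
  have key : ∀ (x : ℂ) (u v : ℝ), ‖x * (Real.exp u : ℝ) - x * (Real.exp v : ℝ)‖ ^ 2 =
      (‖x‖ * Real.exp u) ^ 2 + (‖x‖ * Real.exp v) ^ 2 -
        2 * (‖x‖ * Real.exp ((u + v) / 2)) ^ 2 := by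
    intro x u v
    have h : Real.exp ((u + v) / 2) ^ 2 = Real.exp u * Real.exp v := by
      rw [← Real.exp_nat_mul, ← Real.exp_add]; congr 1; push_cast; ring
    rw [← mul_sub, norm_mul, mul_pow, mul_pow, mul_pow, mul_pow, h, ← Complex.ofReal_sub,
      Complex.norm_real, Real.norm_eq_abs, sq_abs]
    ring
  simp only [sqNorm, Finset.mul_sum, ← Finset.sum_add_distrib, ← Finset.sum_sub_distrib]
  refine Finset.sum_congr rfl fun i _ => ?_
  simp only [norm_act_imagExp_fst, norm_act_imagExp_snd]
  simp only [Prod.fst_sub, Prod.snd_sub, Pi.sub_apply, act_imagExp_fst, act_imagExp_snd, key,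
    Pi.smul_apply, Pi.add_apply, smul_eq_mul]
  rw [show (-(2 * Real.pi * Y i) + -(2 * Real.pi * Z i)) / 2 =
    -(2 * Real.pi * (1 / 2 * (Y i + Z i))) by ring, show
    (2 * Real.pi * Y i + 2 * Real.pi * Z i) / 2 = 2 * Real.pi * (1 / 2 * (Y i + Z i)) by ring]
  ring

/-- The Kempf–Ness function of `p` for the parameter `α`. -/
noncomputable def kempfNess {K : Subgroup (RealTorus N)} (α : KDual K) (p : HN N)
    (Y : lieAlg K) : ℝ :=
  sqNorm (act (imagExp (Y : Fin N → ℝ)) p) / 4 + α Y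

theorem exists_le_exp_add_mul {a : ℝ} (ha : 0 ≤ a) :
    ∃ C, ∀ y, C ≤ Real.exp (-(4 * Real.pi * y)) / 4 + a * y := by
  -- The constant is the minimum for `a > 0`, attained where `exp (-4πy) = a / π`. For `a = 0` it is
  -- `0`, the infimum.
  refine ⟨a / Real.pi * (1 - Real.log (a / Real.pi)) / 4, fun y => ?_⟩
  set b := a / Real.pi with hb
  have hab : a = b * Real.pi := by rw [hb]; field_simp
  have hb0 : 0 ≤ b := div_nonneg ha Real.pi_pos.le
  rcases hb0.eq_or_lt with h | h
  · rw [hab, ← h]; simp; positivity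
  · have h1 := Real.add_one_le_exp (-(4 * Real.pi * y) - Real.log b)
    rw [Real.exp_sub, Real.exp_log h, le_div_iff₀ h] at h1
    rw [hab]
    linarith

/-- Semi-stability splits the function into one-variable functions `exp (∓4πy) / 4 ± a y`, weighted
by `‖z_i‖²` and `‖w_i‖²`. -/
theorem bddBelow_kempfNess {K : Subgroup (RealTorus N)} {α : KDual K} {p : HN N}
    (h : IsSemistable K α p) : BddBelow (Set.range (kempfNess α p)) := by
  obtain ⟨a, b, ha, hb, rfl⟩ := h
  choose C hC using fun i => exists_le_exp_add_mul (ha i)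
  choose D hD using fun i => exists_le_exp_add_mul (hb i)
  refine ⟨∑ i, (‖p.1 i‖ ^ 2 * C i + ‖p.2 i‖ ^ 2 * D i), ?_⟩
  rintro _ ⟨Y, rfl⟩
  simp only [kempfNess, sqNorm_act_imagExp, LinearMap.add_apply, LinearMap.sum_apply,
    LinearMap.smul_apply, LinearMap.neg_apply, smul_eq_mul, Finset.sum_div,
    ← Finset.sum_add_distrib]
  refine Finset.sum_le_sum fun i _ => ?_
  have h1 := mul_le_mul_of_nonneg_left (hC i ((Y : Fin N → ℝ) i)) (sq_nonneg ‖p.1 i‖)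
  have h2 := mul_le_mul_of_nonneg_left (hD i (-(Y : Fin N → ℝ) i)) (sq_nonneg ‖p.2 i‖)
  rw [show -(4 * Real.pi * -(Y : Fin N → ℝ) i) = 4 * Real.pi * (Y : Fin N → ℝ) i by ring] at h2
  have e : weight K i Y = (Y : Fin N → ℝ) i := rfl
  rw [e]
  linarith

/-- The derivative at `0` along `Z` is `α Z - momentR K q Z`; the factor `1 / 4` in `kempfNess` is
chosen for this. -/
theorem momentR_eq_of_forall_le {K : Subgroup (RealTorus N)} {α : KDual K} {q : HN N}
    (h : ∀ Z, kempfNess α q 0 ≤ kempfNess α q Z) : momentR K q = α := by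
  ext Z
  have hder : HasDerivAt (fun s : ℝ => kempfNess α q (s • Z)) (-momentR K q Z + α Z) 0 := by
    simp only [kempfNess, sqNorm_act_imagExp, map_smul, smul_eq_mul, Submodule.coe_smul,
      Pi.smul_apply]
    refine HasDerivAt.add ?_ ((hasDerivAt_mul_const (α Z)))
    rw [momentR_apply, ← Finset.sum_neg_distrib]
    simp only [Finset.sum_div]
    refine HasDerivAt.fun_sum fun i _ => ?_
    set y := (Z : Fin N → ℝ) i
    have h1 : HasDerivAt (fun s : ℝ => 4 * Real.pi * (s * y)) (4 * Real.pi * y) 0 :=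
      (hasDerivAt_mul_const y).const_mul _
    have h2 := ((h1.neg.exp.const_mul (‖q.1 i‖ ^ 2)).add
      (h1.exp.const_mul (‖q.2 i‖ ^ 2))).div_const 4
    refine h2.congr_deriv ?_
    simp
    ring
  have hmin : IsLocalMin (fun s : ℝ => kempfNess α q (s • Z)) 0 :=
    Eventually.of_forall fun s => by simpa using h (s • Z)
  linarith [hmin.hasDerivAt_eq_zero hder]

theorem exists_tendsto_momentR_eq {K : Subgroup (RealTorus N)} {α : KDual K} {p : HN N}
    (h : IsSemistable K α p) : ∃ (Y : ℕ → lieAlg K) (q : HN N),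
      Tendsto (fun n => act (imagExp (Y n : Fin N → ℝ)) p) atTop (𝓝 q) ∧ momentR K q = α ∧
      ∀ Z, ∀ ε > 0, ∀ᶠ n in atTop, kempfNess α p (Y n) ≤ kempfNess α p Z + ε := by
  have hbdd := bddBelow_kempfNess h
  set m := ⨅ Y, kempfNess α p Y
  have hm : ∀ Z, m ≤ kempfNess α p Z := ciInf_le hbdd
  have hex : ∀ n : ℕ, ∃ Y, kempfNess α p Y < m + 1 / ((n : ℝ) + 1) := fun n =>
    exists_lt_of_ciInf_lt (lt_add_of_pos_right _ (by positivity))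
  choose Y hY using hex
  have hsmall : ∀ ε > 0, ∀ᶠ n : ℕ in atTop, 1 / ((n : ℝ) + 1) < ε := fun ε hε =>
    tendsto_one_div_add_atTop_nhds_zero_nat.eventually_lt_const hε
  have hcau : CauchySeq fun n => act (imagExp (Y n : Fin N → ℝ)) p := by
    refine Metric.cauchySeq_iff.2 fun ε hε => ?_
    -- The squared distance is `4 (F(Y k) + F(Y l) - 2 F(midpoint))` with `F = kempfNess α p`, hence
    -- below `4 · 2 · ε² / 8`.
    obtain ⟨M, hM⟩ := eventually_atTop.1 (hsmall (ε ^ 2 / 8) (by positivity))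
    refine ⟨M, fun k hk l hl => ?_⟩
    have h1 := norm_sq_le_sqNorm
      (act (imagExp (Y k : Fin N → ℝ)) p - act (imagExp (Y l : Fin N → ℝ)) p)
    rw [sqNorm_act_imagExp_sub] at h1
    have h2 := hm ((1 / 2 : ℝ) • (Y k + Y l))
    have h3 := hY k
    have h4 := hY l
    simp only [kempfNess, map_smul, map_add, smul_eq_mul, Submodule.coe_smul,
      Submodule.coe_add] at h2 h3 h4
    rw [dist_eq_norm]
    refine lt_of_pow_lt_pow_left₀ 2 hε.le ?_
    linarith [hM k hk, hM l hl]
  obtain ⟨q, hq⟩ := cauchySeq_tendsto_of_complete hcau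
  refine ⟨Y, q, hq, momentR_eq_of_forall_le fun Z => ?_, fun Z ε hε => ?_⟩
  -- Since `Y n` may diverge, differences are used: translating the base point by `Y n` adds `α (Y
  -- n)` to both values, and it cancels.
  · have hcont : Continuous fun x => kempfNess α x Z - kempfNess α x 0 := by
      unfold kempfNess
      have := continuous_sqNorm.comp (continuous_act (imagExp (Z : Fin N → ℝ)))
      have := continuous_sqNorm.comp (continuous_act (imagExp ((0 : lieAlg K) : Fin N → ℝ)))
      simp only [Function.comp_def] at *
      fun_prop
    have hl := (hcont.tendsto q).comp hq
    have h0 : Tendsto (fun n : ℕ => -(1 / ((n : ℝ) + 1))) atTop (𝓝 0) := by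
      simpa using (tendsto_one_div_add_atTop_nhds_zero_nat (𝕜 := ℝ)).neg
    refine sub_nonneg.1 (le_of_tendsto_of_tendsto' h0 hl fun n => ?_)
    have h1 := hm (Z + Y n)
    have h2 := hY n
    simp only [kempfNess, Submodule.coe_add, imagExp_add, act_mul, map_add, Function.comp_apply,
      Submodule.coe_zero, imagExp_zero, act_one, map_zero] at h1 h2 ⊢
    linarith
  · filter_upwards [hsmall ε hε] with n hn
    linarith [hm Z, hY n]

/-! ### The estimate behind properness -/

/-- Otherwise a rescaled unbounded sequence tends to a unit vector `q` of zero moment. Where `q` has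
a nonzero coordinate, that of `p` exceeds `C`, so `Y` must contract it. Pairing the moment of `q`
with `Y` then forces `q = 0`. -/
theorem exists_norm_le_of_momentR_eq {K : Subgroup (RealTorus N)} (α : KDual K) (C : ℝ) :
    ∃ R, ∀ (p : HN N) (Y : lieAlg K), momentR K p = α →
      ‖act (imagExp (Y : Fin N → ℝ)) p‖ ≤ C → ‖p‖ ≤ R := by
  by_contra! hcon
  choose p Y hp hC hR using fun n : ℕ => hcon ((n : ℝ) + 1)
  have hpos : ∀ n, 0 < ‖p n‖ := fun n => lt_trans (by positivity) (hR n)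
  have htop : Tendsto (fun n => ‖p n‖) atTop atTop :=
    tendsto_atTop_mono (fun n => (le_add_of_nonneg_right zero_le_one).trans (hR n).le)
      tendsto_natCast_atTop_atTop
  obtain ⟨q, hq, φ, hφ, hlim⟩ := (isCompact_sphere (0 : HN N) 1).tendsto_subseq
    (x := fun n => ((‖p n‖⁻¹ : ℝ) : ℝ) • p n) fun n => by
      rw [mem_sphere_zero_iff_norm, norm_smul, norm_inv, norm_norm, inv_mul_cancel₀ (hpos n).ne']
  have htop' := htop.comp hφ.tendsto_atTop
  have hinv : Tendsto (fun n => ‖p (φ n)‖⁻¹) atTop (𝓝 0) := tendsto_inv_atTop_zero.comp htop'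
  have hmq : ∀ Z, momentR K q Z = 0 := fun Z => by
    refine tendsto_nhds_unique (((continuous_momentR_apply K Z).tendsto q).comp hlim) ?_
    have : (fun n => (‖p (φ n)‖⁻¹) ^ 2 * α Z) =
        (fun p => momentR K p Z) ∘ (fun n => ((‖p n‖⁻¹ : ℝ) : ℝ) • p n) ∘ φ := by
      funext n
      simp only [Function.comp_apply]
      rw [← hp (φ n), momentR_apply, momentR_apply, Finset.mul_sum]
      refine Finset.sum_congr rfl fun i _ => ?_
      simp only [Prod.smul_fst, Prod.smul_snd, Pi.smul_apply, norm_smul, norm_inv, norm_norm]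
      ring
    rw [← this]
    simpa using (hinv.pow 2).mul_const (α Z)
  have hfst : ∀ i, Tendsto (fun n => ‖p (φ n)‖⁻¹ * ‖(p (φ n)).1 i‖) atTop (𝓝 ‖q.1 i‖) := fun i => by
    have := (((continuous_apply i).comp continuous_fst).norm.tendsto q).comp hlim
    refine this.congr fun n => ?_
    simp
  have hsnd : ∀ i, Tendsto (fun n => ‖p (φ n)‖⁻¹ * ‖(p (φ n)).2 i‖) atTop (𝓝 ‖q.2 i‖) := fun i => by
    have := (((continuous_apply i).comp continuous_snd).norm.tendsto q).comp hlim
    refine this.congr fun n => ?_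
    simp
  have large : ∀ {x : ℕ → ℝ} {a : ℝ}, 0 < a →
      Tendsto (fun n => ‖p (φ n)‖⁻¹ * x n) atTop (𝓝 a) → ∀ᶠ n in atTop, C < x n := by
    intro x a ha hx
    have h := (hinv.mul_const C)
    rw [zero_mul] at h
    filter_upwards [h.eventually_lt hx ha] with n hn
    exact lt_of_mul_lt_mul_left hn (inv_nonneg.2 (norm_nonneg _))
  have h1 : ∀ i, ∀ᶠ n in atTop, q.1 i ≠ 0 → C < ‖(p (φ n)).1 i‖ := fun i => by
    by_cases h : q.1 i = 0
    · simp [h]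
    · simpa [h] using large (norm_pos_iff.2 h) (hfst i)
  have h2 : ∀ i, ∀ᶠ n in atTop, q.2 i ≠ 0 → C < ‖(p (φ n)).2 i‖ := fun i => by
    by_cases h : q.2 i = 0
    · simp [h]
    · simpa [h] using large (norm_pos_iff.2 h) (hsnd i)
  obtain ⟨n, hn1, hn2⟩ := ((eventually_all.2 h1).and (eventually_all.2 h2)).exists
  set y := (Y (φ n) : Fin N → ℝ)
  have b1 : ∀ i, ‖(p (φ n)).1 i‖ * Real.exp (-(2 * Real.pi * y i)) ≤ C := fun i => by
    rw [← norm_act_imagExp_fst]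
    exact ((norm_le_pi_norm _ i).trans (norm_fst_le _)).trans (hC (φ n))
  have b2 : ∀ i, ‖(p (φ n)).2 i‖ * Real.exp (2 * Real.pi * y i) ≤ C := fun i => by
    rw [← norm_act_imagExp_snd]
    exact ((norm_le_pi_norm _ i).trans (norm_snd_le _)).trans (hC (φ n))
  have s1 : ∀ i, q.1 i ≠ 0 → 0 < y i := fun i hi => by
    by_contra! hc
    have : 1 ≤ Real.exp (-(2 * Real.pi * y i)) :=
      Real.one_le_exp (by have := Real.pi_pos; nlinarith)
    have := le_mul_of_one_le_right (norm_nonneg ((p (φ n)).1 i)) this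
    linarith [b1 i, hn1 i hi]
  have s2 : ∀ i, q.2 i ≠ 0 → y i < 0 := fun i hi => by
    by_contra! hc
    have : 1 ≤ Real.exp (2 * Real.pi * y i) :=
      Real.one_le_exp (by have := Real.pi_pos; positivity)
    have := le_mul_of_one_le_right (norm_nonneg ((p (φ n)).2 i)) this
    linarith [b2 i, hn2 i hi]
  have t1 : ∀ i, 0 ≤ ‖q.1 i‖ ^ 2 * y i := fun i => by
    by_cases h : q.1 i = 0
    · simp [h]
    · exact mul_nonneg (sq_nonneg _) (s1 i h).le
  have t2 : ∀ i, 0 ≤ ‖q.2 i‖ ^ 2 * -y i := fun i => by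
    by_cases h : q.2 i = 0
    · simp [h]
    · exact mul_nonneg (sq_nonneg _) (neg_nonneg.2 (s2 i h).le)
  have hsum : ∑ i, (‖q.1 i‖ ^ 2 * y i + ‖q.2 i‖ ^ 2 * -y i) = 0 := by
    have := hmq (Y (φ n))
    rw [momentR_apply] at this
    refine (mul_eq_zero.1 (?_ : Real.pi * _ = 0)).resolve_left Real.pi_ne_zero
    rw [← this, Finset.mul_sum]
    exact Finset.sum_congr rfl fun i _ => by ring
  rw [Finset.sum_eq_zero_iff_of_nonneg fun i _ => add_nonneg (t1 i) (t2 i)] at hsum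
  have hz := fun i => (add_eq_zero_iff_of_nonneg (t1 i) (t2 i)).1 (hsum i (Finset.mem_univ i))
  have hq0 : q = 0 := by
    ext i
    · by_contra h
      exact (mul_pos (pow_pos (norm_pos_iff.2 h) 2) (s1 i h)).ne' (hz i).1
    · by_contra h
      exact (mul_pos (pow_pos (norm_pos_iff.2 h) 2) (neg_pos.2 (s2 i h))).ne' (hz i).2
  simp [hq0] at hq

/-! ### Semi-stable points degenerating to the zero level -/

theorem exists_mem_forall_eq_dotProduct (W : Submodule ℝ (Fin N → ℝ)) (f : W →ₗ[ℝ] ℝ) :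
    ∃ x : W, ∀ y : W, f y = ∑ i, (x : Fin N → ℝ) i * (y : Fin N → ℝ) i := by
  let B : W →ₗ[ℝ] Module.Dual ℝ W := LinearMap.mk₂ ℝ
    (fun x y => ∑ i, (x : Fin N → ℝ) i * (y : Fin N → ℝ) i)
    (fun x x' y => by simp [add_mul, Finset.sum_add_distrib])
    (fun c x y => by simp [mul_assoc, Finset.mul_sum])
    (fun x y y' => by simp [mul_add, Finset.sum_add_distrib])
    (fun c x y => by simp [mul_left_comm, Finset.mul_sum])
  have hB : Function.Injective B := by
    refine (injective_iff_map_eq_zero B).2 fun x hx => ?_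
    have h : ∑ i, (x : Fin N → ℝ) i * (x : Fin N → ℝ) i = 0 := LinearMap.congr_fun hx x
    rw [Finset.sum_eq_zero_iff_of_nonneg fun i _ => mul_self_nonneg _] at h
    ext i
    exact mul_self_eq_zero.1 (h i (Finset.mem_univ i))
  obtain ⟨x, hx⟩ := (LinearMap.injective_iff_surjective_of_finrank_eq_finrank
    Subspace.dual_finrank_eq.symm).1 hB f
  exact ⟨x, fun y => by rw [← hx]; rfl⟩

/-- A functional on `k` is represented by a vector `l ∈ k` supported off `S`, up to the weights
with index in `S`. -/
theorem exists_eq_sum_weight {K : Subgroup (RealTorus N)} (α : KDual K) (S : Fin N → Prop) :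
    ∃ (l : lieAlg K) (d : Fin N → ℝ), (∀ i, S i → (l : Fin N → ℝ) i = 0) ∧
      (∀ i, ¬ S i → d i = 0) ∧ α = ∑ i, ((l : Fin N → ℝ) i + d i) • weight K i := by
  classical
  let L : Fin N → KDual K := fun i => if S i then weight K i else 0
  -- `V` is the part of `k` killed by the weights in `S`. The vector `l` represents `α` on `V`, so
  -- the remainder vanishes on `V` and is a combination of those weights.
  let V : Submodule ℝ (lieAlg K) := ⨅ i, LinearMap.ker (L i)
  let e : V ≃ₗ[ℝ] V.map (lieAlg K).subtype :=
    V.equivMapOfInjective _ (lieAlg K).injective_subtype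
  obtain ⟨x, hx⟩ := exists_mem_forall_eq_dotProduct (V.map (lieAlg K).subtype)
    ((α.comp V.subtype).comp e.symm.toLinearMap)
  obtain ⟨⟨l, hl⟩, rfl⟩ := e.surjective x
  have hα : ∀ y ∈ V, α y = ∑ i, (l : Fin N → ℝ) i * (y : Fin N → ℝ) i := fun y hy => by
    simpa [e] using hx (e ⟨y, hy⟩)
  have hmem : α - ∑ i, (l : Fin N → ℝ) i • weight K i ∈ Submodule.span ℝ (Set.range L) := by
    refine mem_span_of_iInf_ker_le_ker fun y hy => ?_
    rw [LinearMap.mem_ker, LinearMap.sub_apply, hα y hy, sub_eq_zero]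
    simp [LinearMap.sum_apply, weight]
  obtain ⟨c, hc⟩ := (Submodule.mem_span_range_iff_exists_fun ℝ).1 hmem
  refine ⟨l, fun i => if S i then c i else 0, fun i hi => ?_, fun i hi => if_neg hi, ?_⟩
  · have := (Submodule.mem_iInf _).1 hl i
    simpa [L, hi, weight] using this
  · rw [eq_sub_iff_add_eq] at hc
    rw [← hc, add_comm, ← Finset.sum_add_distrib]
    refine Finset.sum_congr rfl fun i _ => ?_
    by_cases h : S i <;> simp [L, h, add_smul]

theorem tendsto_add_sqrt_mul_exp {a : ℂ} {l : ℝ} (h : a = 0 ∨ l = 0) :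
    Tendsto (fun n : ℕ => (a + (√l : ℝ)) * (Real.exp (-(2 * Real.pi * (n * l))) : ℝ)) atTop
      (𝓝 a) := by
  rcases lt_trichotomy l 0 with hl | rfl | hl
  · obtain rfl := h.resolve_right hl.ne
    simp [Real.sqrt_eq_zero_of_nonpos hl.le]
  · simp
  · obtain rfl := h.resolve_right hl.ne'
    have h1 : Tendsto (fun n : ℕ => 2 * Real.pi * (n * l)) atTop atTop :=
      (tendsto_natCast_atTop_atTop.atTop_mul_const hl).const_mul_atTop (by positivity)
    have h2 := (Complex.continuous_ofReal.tendsto _).comp (Real.tendsto_exp_neg_atTop_nhds_zero.comp h1)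
    simpa using h2.const_mul (0 + (√l : ℂ))

/-- The part `l` of `α` off the support of `t` is supplied by new coordinates, which `Exp (√-1 n l)`
contracts to `0` while fixing `t`. The part `d` on the support is made admissible by adding a large
multiple of the relation `momentR K t = 0`. -/
theorem exists_isSemistable_mem_closure {K : Subgroup (RealTorus N)} (α : KDual K) {t : HN N}
    (ht : momentR K t = 0) : ∃ q, IsSemistable K α q ∧ momentC K q = momentC K t ∧
      t ∈ closure {x | ∃ ζ ∈ complexification K, act ζ q = x} := by
  obtain ⟨l, d, hl, hd, hα⟩ := exists_eq_sum_weight α fun i => t.1 i ≠ 0 ∨ t.2 i ≠ 0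
  set y := (l : Fin N → ℝ)
  have h1 : ∀ i, t.1 i = 0 ∨ y i = 0 := fun i => or_iff_not_imp_left.2 fun h => hl i (Or.inl h)
  have h2 : ∀ i, t.2 i = 0 ∨ y i = 0 := fun i => or_iff_not_imp_left.2 fun h => hl i (Or.inr h)
  -- As `√` vanishes on negative reals, at most one of `z_i`, `w_i` is changed and all products `z_i
  -- w_i` are preserved.
  let q : HN N := (fun i => t.1 i + (√(y i) : ℝ), fun i => t.2 i + (√(-y i) : ℝ))
  refine ⟨q, ?_, momentC_eq_of_mul_eq K fun i => ?_, ?_⟩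
  -- `M` makes every coefficient nonnegative; quotients by a vanishing coordinate are `0` by
  -- convention.
  · set M := ∑ i, (|d i| / ‖t.1 i‖ ^ 2 + |d i| / ‖t.2 i‖ ^ 2)
    have hMi : ∀ i, |d i| / ‖t.1 i‖ ^ 2 + |d i| / ‖t.2 i‖ ^ 2 ≤ M := fun i =>
      Finset.single_le_sum (f := fun i => |d i| / ‖t.1 i‖ ^ 2 + |d i| / ‖t.2 i‖ ^ 2)
        (fun i _ => by positivity) (Finset.mem_univ i)
    have hM0 : 0 ≤ M := Finset.sum_nonneg fun i _ => by positivity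
    have hex : ∀ i, ∃ a b : ℝ, 0 ≤ a ∧ 0 ≤ b ∧ a * ‖q.1 i‖ ^ 2 - b * ‖q.2 i‖ ^ 2 =
        y i + d i + M * (‖t.1 i‖ ^ 2 - ‖t.2 i‖ ^ 2) := fun i => by
      have hi := hMi i
      have n1 : 0 ≤ |d i| / ‖t.1 i‖ ^ 2 := by positivity
      have n2 : 0 ≤ |d i| / ‖t.2 i‖ ^ 2 := by positivity
      by_cases hS : t.1 i ≠ 0 ∨ t.2 i ≠ 0
      · have q1 : q.1 i = t.1 i := by simp [q, hl i hS]
        have q2 : q.2 i = t.2 i := by simp [q, hl i hS]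
        rw [q1, q2, hl i hS]
        by_cases hz : t.1 i = 0
        · have hw : ‖t.2 i‖ ≠ 0 := norm_ne_zero_iff.2 (hS.resolve_left (not_not.2 hz))
          refine ⟨M, M - d i / ‖t.2 i‖ ^ 2, hM0, ?_, by field_simp; ring⟩
          have : d i / ‖t.2 i‖ ^ 2 ≤ |d i| / ‖t.2 i‖ ^ 2 := by gcongr; exact le_abs_self _
          linarith
        · have hz' : ‖t.1 i‖ ≠ 0 := norm_ne_zero_iff.2 hz
          refine ⟨M + d i / ‖t.1 i‖ ^ 2, M, ?_, hM0, by field_simp; ring⟩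
          have : -(|d i| / ‖t.1 i‖ ^ 2) ≤ d i / ‖t.1 i‖ ^ 2 := by
            rw [← neg_div]; gcongr; exact neg_abs_le _
          linarith
      · have hd0 := hd i hS
        push Not at hS
        refine ⟨1, 1, zero_le_one, zero_le_one, ?_⟩
        have q1 : ‖q.1 i‖ = √(y i) := by
          simp [q, hS.1, abs_of_nonneg (Real.sqrt_nonneg _)]
        have q2 : ‖q.2 i‖ = √(-y i) := by
          simp [q, hS.2, abs_of_nonneg (Real.sqrt_nonneg _)]
        rw [q1, q2, hd0, hS.1, hS.2]
        rcases le_total 0 (y i) with h | h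
        · rw [Real.sq_sqrt h, Real.sqrt_eq_zero_of_nonpos (neg_nonpos.2 h)]; simp
        · rw [Real.sq_sqrt (neg_nonneg.2 h), Real.sqrt_eq_zero_of_nonpos h]; simp
    choose a b ha hb hab using hex
    refine ⟨a, b, ha, hb, ?_⟩
    have h0 : (M / Real.pi) • momentR K t = 0 := by rw [ht, smul_zero]
    rw [← add_zero α, ← h0, hα, momentR, Finset.smul_sum, ← Finset.sum_add_distrib,
      ← Finset.sum_add_distrib]
    refine Finset.sum_congr rfl fun i _ => ?_
    rw [smul_neg, ← neg_smul, ← add_smul, smul_smul, ← add_smul, ← sub_eq_add_neg, hab]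
    congr 1
    field_simp
  · rcases le_total 0 (y i) with h | h
    · have e : √(-y i) = 0 := Real.sqrt_eq_zero_of_nonpos (neg_nonpos.2 h)
      rcases h2 i with h' | h' <;> simp [q, e, h']
    · have e : √(y i) = 0 := Real.sqrt_eq_zero_of_nonpos h
      rcases h1 i with h' | h' <;> simp [q, e, h']
  · refine mem_closure_of_tendsto (b := atTop)
      (f := fun n : ℕ => act (imagExp (((n : ℝ) • l : lieAlg K) : Fin N → ℝ)) q) ?_
      (Eventually.of_forall fun n => ⟨_, imagExp_mem _, rfl⟩)
    refine Tendsto.prodMk_nhds (tendsto_pi_nhds.2 fun i => ?_) (tendsto_pi_nhds.2 fun i => ?_)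
    · refine (tendsto_add_sqrt_mul_exp (h1 i)).congr fun n => ?_
      exact (act_imagExp_fst ((n : ℝ) • y) q i).symm
    · refine (tendsto_add_sqrt_mul_exp (l := -y i) ((h2 i).imp_right neg_eq_zero.2)).congr
        fun n => ?_
      rw [mul_neg, mul_neg, neg_neg]
      exact (act_imagExp_snd ((n : ℝ) • y) q i).symm

/-! ### Topology of the quotients -/

variable {K : Subgroup (RealTorus N)} {α : KDual K} {β : KDualC K}

theorem IsSemistable.act {p : HN N} (h : IsSemistable K α p) (ζ : ComplexTorus N) :
    IsSemistable K α (act ζ p) := by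
  obtain ⟨a, b, ha, hb, hα⟩ := h
  refine ⟨fun i => a i / ‖(ζ i : ℂ)‖ ^ 2, fun i => b i * ‖(ζ i : ℂ)‖ ^ 2,
    fun i => div_nonneg (ha i) (sq_nonneg _), fun i => mul_nonneg (hb i) (sq_nonneg _), ?_⟩
  rw [hα]
  have hζ : ∀ i, ‖(ζ i : ℂ)‖ ≠ 0 := fun i => norm_ne_zero_iff.2 (ζ i).ne_zero
  congr 1 <;> refine Finset.sum_congr rfl fun i _ => ?_ <;> congr 1 <;>
    simp only [ToricHyperkahler.act, norm_mul, Units.val_inv_eq_inv_val, norm_inv] <;>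
    have := hζ i <;> field_simp

theorem mem_closure_orbit_iff {p r : Semistable K α β} :
    r ∈ closure (orbit p) ↔ r.1 ∈ closure {x | ∃ ζ ∈ complexification K, act ζ p.1 = x} := by
  rw [closure_subtype]
  congr! 2
  ext x
  constructor
  · rintro ⟨q, ⟨ζ, hζ, h⟩, rfl⟩
    exact ⟨ζ, hζ, h⟩
  · rintro ⟨ζ, hζ, rfl⟩
    exact ⟨⟨act ζ p.1, by rw [momentC_act, p.2.1], p.2.2.act ζ⟩, ⟨ζ, hζ, rfl⟩, rfl⟩

theorem exists_level_mem_closure_orbit (p : Semistable K α β) :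
    ∃ r : Level K α β, levelToSemistable r ∈ closure (orbit p) := by
  obtain ⟨Y, q, hq, hm, -⟩ := exists_tendsto_momentR_eq p.2.2
  refine ⟨⟨q, hm, (isClosed_momentC_eq K β).mem_of_tendsto hq
    (Eventually.of_forall fun n => ?_)⟩, mem_closure_orbit_iff.2 (mem_closure_of_tendsto hq
      (Eventually.of_forall fun n => ⟨_, imagExp_mem _, rfl⟩))⟩
  exact (momentC_act K _ _).trans p.2.1

theorem exists_level_zero_mem_closure_orbit (p : Semistable K 0 β) :
    ∃ r : Level K 0 β, levelToSemistable r ∈ closure (orbit p) ∧ sqNorm r.1 ≤ sqNorm p.1 := by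
  obtain ⟨Y, q, hq, hm, hle⟩ := exists_tendsto_momentR_eq p.2.2
  refine ⟨⟨q, hm, (isClosed_momentC_eq K β).mem_of_tendsto hq
    (Eventually.of_forall fun n => ?_)⟩, mem_closure_orbit_iff.2 (mem_closure_of_tendsto hq
      (Eventually.of_forall fun n => ⟨_, imagExp_mem _, rfl⟩)), ?_⟩
  · exact (momentC_act K _ _).trans p.2.1
  · refine le_of_forall_pos_le_add fun ε hε => ?_
    refine le_of_tendsto ((continuous_sqNorm.tendsto q).comp hq) ?_
    filter_upwards [hle 0 (ε / 4) (by positivity)] with n hn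
    simp only [kempfNess, Submodule.coe_zero, imagExp_zero, act_one, LinearMap.zero_apply] at hn
    simp only [Function.comp_apply]
    linarith

/-- A point of the zero level set in the closure of the `K_ℂ`-orbit of `p`. -/
noncomputable def levelRep (p : Semistable K 0 β) : Level K 0 β :=
  (exists_level_zero_mem_closure_orbit p).choose

theorem levelRep_mem (p : Semistable K 0 β) :
    levelToSemistable (levelRep p) ∈ closure (orbit p) :=
  (exists_level_zero_mem_closure_orbit p).choose_spec.1

theorem sqNorm_levelRep_le (p : Semistable K 0 β) : sqNorm (levelRep p).1 ≤ sqNorm p.1 :=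
  (exists_level_zero_mem_closure_orbit p).choose_spec.2

theorem orbitGraphClosure_levelRep (p : Semistable K 0 β) {q : HN N}
    (h : (p.1, q) ∈ orbitGraphClosure K) : ((levelRep p).1, q) ∈ orbitGraphClosure K :=
  orbitGraphClosure_of_mem_closure h (mem_closure_orbit_iff.1 (levelRep_mem p))

theorem level_mk_eq_iff (hK : IsClosed (K : Set (RealTorus N))) {p q : Level K α β} :
    (Quotient.mk (levelSetoid K α β) p = Quotient.mk _ q) ↔
      (p.1, q.1) ∈ orbitGraphClosure K := by
  rw [Quotient.eq]
  constructor
  · rintro ⟨g, hg, h⟩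
    exact subset_closure ⟨_, toComplexTorus_mem hg, h⟩
  · intro h
    exact exists_act_eq_of_mem_orbitGraphClosure hK h (p.2.1.trans q.2.1.symm)

theorem isOpenQuotientMap_level_mk :
    IsOpenQuotientMap (Quotient.mk (levelSetoid K α β)) := by
  refine ⟨Quotient.mk_surjective, continuous_quotient_mk', fun V hV => ?_⟩
  let A : K → Level K α β → Level K α β := fun g p => ⟨act (toComplexTorus g) p.1,
    (momentR_act_toComplexTorus K _ _).trans p.2.1, (momentC_act K _ _).trans p.2.2⟩
  have hA : ∀ g, Continuous (A g) := fun g =>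
    ((continuous_act _).comp continuous_subtype_val).subtype_mk _
  refine isQuotientMap_quotient_mk'.isOpen_preimage.1 ?_
  have : Quotient.mk (levelSetoid K α β) ⁻¹' (Quotient.mk (levelSetoid K α β) '' V) =
      ⋃ g, A g ⁻¹' V := by
    ext p
    simp only [Set.mem_preimage, Set.mem_image, Set.mem_iUnion]
    constructor
    · rintro ⟨q, hq, h⟩
      obtain ⟨g, hg, h⟩ := Quotient.exact h.symm
      refine ⟨⟨g, hg⟩, ?_⟩
      rwa [show A ⟨g, hg⟩ p = q from Subtype.ext h]
    · rintro ⟨g, hg⟩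
      exact ⟨A g p, hg, Quotient.sound (Setoid.symm' _ ⟨g, g.2, rfl⟩)⟩
  exact this ▸ isOpen_iUnion fun g => hV.preimage (hA g)

/-- The quotient map is open, and on a level set the orbit relation equals its own closure. -/
theorem t2Space_X (hK : IsClosed (K : Set (RealTorus N))) : T2Space (X K α β) := by
  refine (t2Space_iff_of_isOpenQuotientMap isOpenQuotientMap_level_mk).2 ?_
  simp only [level_mk_eq_iff hK]
  exact isClosed_closure.preimage
    (by fun_prop : Continuous fun q : Level K α β × Level K α β => (q.1.1, q.2.1))

theorem exists_tendsto_of_eventually_norm_le {ι : Type*} (U : Ultrafilter ι) {f : ι → HN N}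
    {R : ℝ} (h : ∀ᶠ x in (U : Filter ι), ‖f x‖ ≤ R) :
    ∃ q, Tendsto f (U : Filter ι) (𝓝 q) := by
  have hmap : Tendsto f (U : Filter ι) (𝓟 (Metric.closedBall (0 : HN N) R)) :=
    tendsto_principal.2 (h.mono fun x hx => mem_closedBall_zero_iff.2 hx)
  obtain ⟨q, -, hq⟩ := (isCompact_closedBall (0 : HN N) R).ultrafilter_le_nhds (U.map f) hmap
  exact ⟨q, hq⟩

/-- `levelRep` itself need not be continuous. Its norm bound gives limits along ultrafilters, and
the closed graph identifies the class of each limit. -/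
theorem continuous_mk_levelRep (hK : IsClosed (K : Set (RealTorus N))) :
    Continuous fun p : Semistable K 0 β => (Quotient.mk _ (levelRep p) : X K 0 β) := by
  refine continuous_iff_ultrafilter.2 fun p g hg => ?_
  have hval : Tendsto (fun x : Semistable K 0 β => x.1) g (𝓝 p.1) :=
    (continuous_subtype_val.tendsto p).mono_left hg
  have hev : ∀ᶠ x in (g : Filter (Semistable K 0 β)),
      ‖(levelRep x).1‖ ≤ √(sqNorm p.1 + 1) := by
    filter_upwards [((continuous_sqNorm.tendsto _).comp hval).eventually_lt_const
      (lt_add_one (sqNorm p.1))] with x hx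
    exact Real.le_sqrt_of_sq_le (((norm_sq_le_sqNorm _).trans (sqNorm_levelRep_le x)).trans hx.le)
  obtain ⟨q, hq⟩ := exists_tendsto_of_eventually_norm_le g hev
  have hlev : momentR K q = 0 ∧ momentC K q = β :=
    ⟨(isClosed_momentR_eq K 0).mem_of_tendsto hq (Eventually.of_forall fun x => (levelRep x).2.1),
      (isClosed_momentC_eq K β).mem_of_tendsto hq (Eventually.of_forall fun x => (levelRep x).2.2)⟩
  have hΓ : (p.1, q) ∈ orbitGraphClosure K :=
    isClosed_closure.mem_of_tendsto (hval.prodMk_nhds hq) (Eventually.of_forall fun x =>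
      orbitGraphClosure_symm (orbitGraphClosure_levelRep x (orbitGraphClosure_refl K x.1)))
  have he : (Quotient.mk _ (levelRep p) : X K 0 β) = Quotient.mk _ ⟨q, hlev⟩ :=
    (level_mk_eq_iff hK).2 (orbitGraphClosure_levelRep p hΓ)
  rw [he]
  exact (continuous_quotient_mk'.tendsto (⟨q, hlev⟩ : Level K 0 β)).comp
    (tendsto_subtype_rng.2 hq)

theorem mk_levelRep_eq (hK : IsClosed (K : Set (RealTorus N))) {p q : Semistable K 0 β}
    (h : OrbitClosuresMeet p q) :
    (Quotient.mk _ (levelRep p) : X K 0 β) = Quotient.mk _ (levelRep q) := by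
  obtain ⟨r, hp, hq⟩ := h
  have key : ∀ s : Semistable K 0 β, r ∈ closure (orbit s) →
      (Quotient.mk _ (levelRep r) : X K 0 β) = Quotient.mk _ (levelRep s) := fun s hs =>
    (level_mk_eq_iff hK).2 (orbitGraphClosure_levelRep r (orbitGraphClosure_of_mem_closure
      (orbitGraphClosure_symm (orbitGraphClosure_levelRep s (orbitGraphClosure_refl K s.1)))
      (mem_closure_orbit_iff.1 hs)))
  rw [← key p hp, ← key q hq]

theorem continuous_levelToSemistable :
    Continuous (levelToSemistable (K := K) (α := α) (β := β)) :=
  continuous_subtype_val.subtype_mk _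

theorem continuous_toGIT : Continuous (toGIT K α β) :=
  (continuous_quot_mk.comp continuous_levelToSemistable).quotient_lift _

theorem continuous_semistableInclusion :
    Continuous (semistableInclusion (K := K) (α := α) (β := β)) :=
  continuous_subtype_val.subtype_mk _

theorem continuous_gitMap : Continuous (gitMap K α β) :=
  continuous_quot_lift _ (continuous_quot_mk.comp continuous_semistableInclusion)

theorem git_mk_eq_of_mem_closure {p r : Semistable K α β} (h : r ∈ closure (orbit p)) :
    (Quot.mk _ r : GIT K α β) = Quot.mk _ p :=
  Quot.sound ⟨r, subset_closure (mem_orbit_self r), h⟩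

theorem surjective_toGIT : Function.Surjective (toGIT K α β) := by
  rintro ⟨p⟩
  obtain ⟨r, hr⟩ := exists_level_mem_closure_orbit p
  exact ⟨Quotient.mk _ r, git_mk_eq_of_mem_closure hr⟩

/-- The Kempf–Ness homeomorphism between `μ_ℂ⁻¹ (β) // K_ℂ` and `X(0, β)`. -/
noncomputable def gitZeroHomeomorph (hK : IsClosed (K : Set (RealTorus N))) (β : KDualC K) :
    GIT K 0 β ≃ₜ X K 0 β where
  toFun := Quot.lift (fun p => Quotient.mk _ (levelRep p)) fun _ _ => mk_levelRep_eq hK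
  invFun := toGIT K 0 β
  left_inv := by
    rintro ⟨p⟩
    exact git_mk_eq_of_mem_closure (levelRep_mem p)
  right_inv := by
    rintro ⟨p⟩
    exact (level_mk_eq_iff hK).2 (orbitGraphClosure_levelRep (levelToSemistable p)
      (orbitGraphClosure_refl K p.1))
  continuous_toFun := continuous_quot_lift _ (continuous_mk_levelRep hK)
  continuous_invFun := continuous_toGIT

/-! ### Properness and surjectivity -/

theorem exists_norm_act_imagExp_lt {p : Semistable K α β} {r : Semistable K α β}
    (h : r ∈ closure (orbit p)) :
    ∃ Y : lieAlg K, ‖act (imagExp (Y : Fin N → ℝ)) p.1‖ < ‖r.1‖ + 1 := by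
  obtain ⟨x, ⟨ζ, ⟨g, hg, Y, hY, rfl⟩, rfl⟩, hx⟩ :=
    Metric.mem_closure_iff.1 (mem_closure_orbit_iff.1 h) 1 one_pos
  refine ⟨⟨Y, hY⟩, ?_⟩
  rw [act_mul, dist_comm, dist_eq_norm] at hx
  have := norm_sub_norm_le (act (toComplexTorus g) (act (imagExp Y) p.1)) r.1
  rw [norm_act_toComplexTorus] at this
  linarith

/-- The squared norm on `X(α, β)`. -/
noncomputable def sqNormX (x : X K α β) : ℝ :=
  Quotient.lift (fun p : Level K α β => sqNorm p.1) (by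
    rintro p q ⟨g, -, h⟩
    rw [← h, sqNorm_act_toComplexTorus]) x

theorem continuous_sqNormX : Continuous (sqNormX (K := K) (α := α) (β := β)) :=
  (continuous_sqNorm.comp continuous_subtype_val).quotient_lift _

/-- The orbit of `p` comes within distance `1` of its representative, so
`exists_norm_le_of_momentR_eq` applies with radius `√C + 1`. -/
theorem exists_norm_le_of_sqNorm_levelRep_le (α : KDual K) (β : KDualC K) (C : ℝ) :
    ∃ R, ∀ p : Level K α β,
      sqNorm (levelRep (semistableInclusion (levelToSemistable p))).1 ≤ C → ‖p.1‖ ≤ R := by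
  obtain ⟨R, hR⟩ := exists_norm_le_of_momentR_eq α (√C + 1)
  refine ⟨R, fun p hp => ?_⟩
  obtain ⟨Y, hY⟩ := exists_norm_act_imagExp_lt
    (levelRep_mem (semistableInclusion (levelToSemistable p)))
  refine hR p.1 Y p.2.1 (hY.le.trans (add_le_add_left ?_ 1))
  exact Real.le_sqrt_of_sq_le ((norm_sq_le_sqNorm _).trans hp)

theorem isProperMap_mk_levelRep (hK : IsClosed (K : Set (RealTorus N))) :
    IsProperMap fun p : Level K α β =>
      (Quotient.mk _ (levelRep (semistableInclusion (levelToSemistable p))) : X K 0 β) := by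
  have := t2Space_X (α := 0) (β := β) hK
  refine isProperMap_iff_ultrafilter_of_t2.2 ⟨(continuous_mk_levelRep hK).comp
    (continuous_semistableInclusion.comp continuous_levelToSemistable), fun U y hU => ?_⟩
  -- Convergence of the images bounds the representatives through `sqNormX`, hence the points
  -- themselves.
  obtain ⟨R, hR⟩ := exists_norm_le_of_sqNorm_levelRep_le α β (sqNormX y + 1)
  have hev : ∀ᶠ p in (U : Filter (Level K α β)), ‖p.1‖ ≤ R := by
    filter_upwards [((continuous_sqNormX.tendsto y).comp hU).eventually_lt_const
      (lt_add_one _)] with p hp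
    exact hR p hp.le
  obtain ⟨q, hq⟩ := exists_tendsto_of_eventually_norm_le U hev
  have hlev : momentR K q = α ∧ momentC K q = β :=
    ⟨(isClosed_momentR_eq K α).mem_of_tendsto hq (Eventually.of_forall fun x => x.2.1),
      (isClosed_momentC_eq K β).mem_of_tendsto hq (Eventually.of_forall fun x => x.2.2)⟩
  exact ⟨⟨q, hlev⟩, tendsto_subtype_rng.2 hq⟩

/-- The composite `X(α, β) → μ_ℂ⁻¹ (β)^{α-ss} // K_ℂ → μ_ℂ⁻¹ (β) // K_ℂ ≃ X(0, β)` is proper. -/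
theorem isProperMap_gitZeroHomeomorph_comp (hK : IsClosed (K : Set (RealTorus N))) :
    IsProperMap (gitZeroHomeomorph hK β ∘ gitMap K α β ∘ toGIT K α β) :=
  isProperMap_of_comp_of_surj continuous_quotient_mk'
    ((gitZeroHomeomorph hK β).continuous.comp (continuous_gitMap.comp continuous_toGIT))
    (isProperMap_mk_levelRep hK) Quotient.mk_surjective

theorem surjective_gitMap : Function.Surjective (gitMap K α β) := by
  intro y
  obtain ⟨⟨t⟩, rfl⟩ := surjective_toGIT y
  obtain ⟨q, hq, hm, hcl⟩ := exists_isSemistable_mem_closure α t.2.1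
  exact ⟨Quot.mk _ ⟨q, hm.trans t.2.2, hq⟩,
    (git_mk_eq_of_mem_closure (mem_closure_orbit_iff.2 hcl)).symm⟩

theorem isMorphism_gitMap : IsMorphism (gitMap K α β) :=
  ⟨continuous_gitMap, fun U f _ hf p hp => by
    obtain ⟨V, hV, hpV, F, hF, h⟩ := hf (semistableInclusion p) hp
    exact ⟨V, hV, hpV, F, hF, fun q => h (semistableInclusion q)⟩⟩

/-- Properness descends along the continuous surjection `toGIT`; no homeomorphism is needed for
general `α`. -/
theorem isProperMap_gitMap (hK : IsClosed (K : Set (RealTorus N))) :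
    IsProperMap (gitMap K α β) := by
  have h := isProperMap_of_comp_of_surj continuous_toGIT
    ((gitZeroHomeomorph hK β).continuous.comp continuous_gitMap)
    (isProperMap_gitZeroHomeomorph_comp (α := α) hK) surjective_toGIT
  have h' := (gitZeroHomeomorph hK β).symm.isProperMap.comp h
  rwa [← Function.comp_assoc, Homeomorph.symm_comp_self, Function.id_comp] at h'

/-- `toGIT K 0 β` is the inverse of `gitZeroHomeomorph`, so the defining equation can be solved for
`π`. -/
theorem isNaturalMap_iff (hK : IsClosed (K : Set (RealTorus N))) {π : X K α β → X K 0 β} :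
    IsNaturalMap K α β π ↔ π = gitZeroHomeomorph hK β ∘ gitMap K α β ∘ toGIT K α β := by
  rw [funext_iff]
  exact forall_congr' fun x => (gitZeroHomeomorph hK β).symm_apply_eq

end ToricHyperkahler

theorem mainTheorem5 (N : ℕ) (K : Subgroup (ToricHyperkahler.RealTorus N))
    (hclosed : IsClosed (K : Set (ToricHyperkahler.RealTorus N)))
    (hconn : IsConnected (K : Set (ToricHyperkahler.RealTorus N)))
    (α : ToricHyperkahler.KDual K) (β : ToricHyperkahler.KDualC K) :
    (ToricHyperkahler.IsMorphism (ToricHyperkahler.gitMap K α β) ∧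
      IsProperMap (ToricHyperkahler.gitMap K α β) ∧
      Function.Surjective (ToricHyperkahler.gitMap K α β)) ∧
    (∃! π₁ : ToricHyperkahler.X K α β → ToricHyperkahler.X K 0 β,
      ToricHyperkahler.IsNaturalMap K α β π₁) ∧
    (∀ π₁ : ToricHyperkahler.X K α β → ToricHyperkahler.X K 0 β,
      ToricHyperkahler.IsNaturalMap K α β π₁ →
        IsProperMap π₁ ∧ Function.Surjective π₁) := by
  open ToricHyperkahler in
  refine ⟨⟨isMorphism_gitMap, isProperMap_gitMap hclosed, surjective_gitMap⟩,
    ⟨_, (isNaturalMap_iff hclosed).2 rfl, fun _ => (isNaturalMap_iff hclosed).1⟩,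
    fun π h => ?_⟩
  obtain rfl := (ToricHyperkahler.isNaturalMap_iff hclosed).1 h
  exact ⟨ToricHyperkahler.isProperMap_gitZeroHomeomorph_comp hclosed,
    (ToricHyperkahler.gitZeroHomeomorph hclosed β).surjective.comp
      (ToricHyperkahler.surjective_gitMap.comp ToricHyperkahler.surjective_toGIT)⟩
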